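/- Let $\mathbb B$ be the groupoid of finite ordinals $\underline n=\{0,\dots,n-1\}$ and all bijections, let $\mathbb B'\to\mathbb B$ be the groupoid of pointed finite ordinals over it, and let $\mathsf S$ be the symmetric monoidal category monad on the category $\mathbf{Grpd}$ of groupoids: $\mathsf S X=\int^{n\in\mathbb B}\mathrm{Map}(\underline n,X)$, i.e. the objects of $\mathsf S X$ are the finite tuples of objects of $X$, an arrow is a bijection of index sets together with a family of arrows of $X$, the unit $\eta^{\mathsf S}$ is the inclusion of singleton tuples and the multiplication $\mu^{\mathsf S}$ is concatenation. Let $\mathsf R$ be a coloured symmetric operad (in sets) with set of colours $I$, regarded as a polynomial monad cartesian over $\mathsf S$. That is: given are a diagram of groupoids $I\xleftarrow{s}E\xrightarrow{p}B\xrightarrow{t}I$ and a discrete fibration $B\to\mathbb B$ with $E=B\times_{\mathbb B}\mathbb B'$, and a monad structure $(\eta,\mu)$ on the polynomial functor $\mathsf R=t_!\,p_*\,s^*$ on the strict slice $\mathbf{Grpd}/I$, such that the induced natural transformation $\phi:F_!\mathsf R\Rightarrow \mathsf S F_!$, where $F:I\to 1$ and $F_!:\mathbf{Grpd}/I\to\mathbf{Grpd}$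 is the forgetful functor, is compatible with the units and the multiplications: $$\phi\circ F_!\eta=\eta^{\mathsf S}F_!,\qquad \phi\circ F_!\mu=\mu^{\mathsf S}F_!\circ \mathsf S\phi\circ\phi\mathsf R .$$ Let $A$ be the terminal object of $\mathbf{Grpd}/I$, with its unique $\mathsf R$-algebra structure $\alpha:\mathsf RA\to A$, and let $D_\bullet=\mathsf S F_!\mathsf R^\bullet A$ be the simplicial groupoid (relative bar construction) with $D_n=\mathsf S F_!\mathsf R^nA$, with degeneracy maps $s_k=\mathsf S F_!\mathsf R^{n-k}\eta_{\mathsf R^kA}:D_n\to D_{n+1}$ $(0\le k\le n)$, with face maps $d_k=\mathsf S F_!\mathsf R^{n-k}\mu_{\mathsf R^{k-1}A}:D_{n+1}\to D_n$ for $0\le k\le n$, where $\mu_{\mathsf R^{-1}A}:=\alpha$, and with top face map $d_{n+1}=\mu^{\mathsf S}_{F_!\mathsf R^nA}\circ\mathsf S(\phi_{\mathsf R^nA}):D_{n+1}\to D_n$. Then $D_\bullet$ is a Segal groupoid: for every $n\ge 0$ the commutative square $$\begin{array}{ccc} D_{n+2} & \xrightarrow{\;d_0\;} & D_{n+1}\\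 {\scriptstyle d_{n+2}}\downarrow & & \downarrow{\scriptstyle d_{n+1}}\\ D_{n+1} & \xrightarrow{\;d_0\;} & D_n\end{array}$$ which is a strict pullback of groupoids (so that $D_\bullet$ is a category object), is also a homotopy pullback. -/

import Mathlib

open CategoryTheory CategoryTheory.Limits

universe u v w u' v'

namespace FaaDiBruno

/-! ### The groupoid of finite sets and bijections, and the symmetric monoidal category monad -/

/-- The groupoid `𝔹` of finite sets and bijections, in its skeletal form: the objects are the
finite ordinals `{0, …, n - 1}`, and the arrows are all bijections. -/
structure FinBij : Type where
  card : ℕ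

instance : Groupoid FinBij where
  Hom a b := Fin a.card ≃ Fin b.card
  id _ := Equiv.refl _
  comp f g := f.trans g
  inv f := f.symm
  inv_comp f := Equiv.symm_trans_self f
  comp_inv f := Equiv.self_trans_symm f

/-- The functor sending a finite ordinal to its underlying set. Its category of elements is the
groupoid `𝔹'` of pointed finite sets, with its discrete fibration `𝔹' ⥤ 𝔹`. -/
def FinBij.toType : FinBij ⥤ Type where
  obj a := Fin a.card
  map f := TypeCat.ofHom (fun i => (show Fin _ ≃ Fin _ from f) i)

section FamHom

variable {X : Type u} [Groupoid.{v} X] {ι κ l : Type*}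

/-- A map between families of objects of `X`: a bijection of index sets together with a family
of arrows of `X`. -/
structure FamHom (x : ι → X) (y : κ → X) where
  perm : ι ≃ κ
  fam : ∀ i, x i ⟶ y (perm i)

namespace FamHom

/-- Identity. -/
def id (x : ι → X) : FamHom x x := ⟨Equiv.refl _, fun _ => 𝟙 _⟩

/-- Composition. -/
def comp {x : ι → X} {y : κ → X} {z : l → X} (f : FamHom x y) (g : FamHom y z) : FamHom x z :=
  ⟨f.perm.trans g.perm, fun i => f.fam i ≫ g.fam (f.perm i)⟩

/-- Inverse. -/
def inv {x : ι → X} {y : κ → X} (f : FamHom x y) : FamHom y x :=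
  ⟨f.perm.symm, fun j => eqToHom (by simp) ≫ Groupoid.inv (f.fam (f.perm.symm j))⟩

/-- Reindexing along a bijection. -/
def reindex (x : κ → X) (e : ι ≃ κ) : FamHom (fun i => x (e i)) x := ⟨e, fun _ => 𝟙 _⟩

theorem ext_heq {x : ι → X} {y : κ → X} {f g : FamHom x y}
    (hp : ∀ i, f.perm i = g.perm i) (hf : ∀ i, f.fam i ≍ g.fam i) : f = g := by
  obtain ⟨p, f⟩ := f
  obtain ⟨q, g⟩ := g
  obtain rfl : p = q := Equiv.ext hp
  congr
  funext i
  exact eq_of_heq (hf i)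

theorem fam_congr {x : ι → X} {y : κ → X} (f : FamHom x y) {i j : ι} (h : i = j) :
    f.fam i ≍ f.fam j := by subst h; rfl

theorem assoc {m : Type*} {x : ι → X} {y : κ → X} {z : l → X} {t : m → X} (f : FamHom x y)
    (g : FamHom y z) (h : FamHom z t) : (f.comp g).comp h = f.comp (g.comp h) :=
  ext_heq (fun _ => rfl) (fun _ => by simp [comp])

theorem id_comp {x : ι → X} {y : κ → X} (f : FamHom x y) : (FamHom.id x).comp f = f :=
  ext_heq (fun _ => rfl) (fun _ => by simp [comp, id])

theorem comp_id {x : ι → X} {y : κ → X} (f : FamHom x y) : f.comp (FamHom.id y) = f :=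
  ext_heq (fun _ => rfl) (fun _ => by simp [comp, id])

theorem inv_comp {x : ι → X} {y : κ → X} (f : FamHom x y) : f.inv.comp f = FamHom.id y :=
  ext_heq (fun j => by simp [comp, inv, id]) (fun j => by
    have key : ∀ (k : κ) (_ : k = j) (e : y j = y k), eqToHom e ≍ 𝟙 (y j) := by
      rintro k rfl e
      simp
    have hj : (f.inv.comp f).perm j = j := f.perm.apply_symm_apply j
    have h : (f.inv.comp f).fam j = eqToHom (congrArg y hj.symm) := by simp [comp, inv]
    rw [h]
    exact key _ hj _)

theorem comp_inv {x : ι → X} {y : κ → X} (f : FamHom x y) : f.comp f.inv = FamHom.id x :=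
  ext_heq (fun j => by simp [comp, inv, id]) (fun j => by
    have key : ∀ (k : ι) (hk : k = j) (e : y (f.perm j) = y (f.perm k)),
        f.fam j ≫ eqToHom e ≫ Groupoid.inv (f.fam k) ≍ 𝟙 (x j) := by
      rintro k rfl e
      simp
    exact key _ (by simp) _)

theorem comp_inv_reindex_fam {m : Type*} {x : ι → X} {y : κ → X} (f : FamHom x y)
    (e : m ≃ κ) (i : ι) : (f.comp (reindex y e).inv).fam i ≍ f.fam i := by
  simp [comp, reindex, inv]

end FamHom

end FamHom

/-- The underlying set of objects of `S X = ∫^{n ∈ 𝔹} Map(n, X)`: a finite ordinal `n` with an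
`n`-tuple of objects of `X`. -/
structure Sym (X : Type u) : Type u where
  card : ℕ
  val : Fin card → X

/-- The groupoid `S X = ∫^{n ∈ 𝔹} Map(n, X)`: an arrow is a bijection of index sets together with
a family of arrows of `X`. -/
instance (X : Type u) [Groupoid.{v} X] : Groupoid.{v} (Sym X) where
  Hom a b := FamHom a.val b.val
  id a := FamHom.id a.val
  comp f g := FamHom.comp f g
  id_comp f := FamHom.id_comp f
  comp_id f := FamHom.comp_id f
  assoc f g h := FamHom.assoc f g h
  inv f := FamHom.inv f
  inv_comp f := FamHom.inv_comp f
  comp_inv f := FamHom.comp_inv f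

namespace Sym

theorem obj_ext {X : Type u} {a b : Sym X} (h : a.card = b.card) (hv : ∀ i, a.val i = b.val (Fin.cast h i)) :
    a = b := by
  obtain ⟨n, x⟩ := a
  obtain ⟨m, y⟩ := b
  obtain rfl : n = m := h
  obtain rfl : x = y := funext hv
  rfl

section

variable {X : Type u} [Groupoid.{v} X]

/-- The underlying bijection of an arrow of `S X`. -/
abbrev perm {a b : Sym X} (f : a ⟶ b) : Fin a.card ≃ Fin b.card := FamHom.perm f

/-- The underlying family of arrows of an arrow of `S X`. -/
abbrev fam {a b : Sym X} (f : a ⟶ b) (i : Fin a.card) : a.val i ⟶ b.val (perm f i) :=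
  FamHom.fam f i

theorem perm_comp {a b c : Sym X} (f : a ⟶ b) (g : b ⟶ c) (i : Fin a.card) :
    perm (f ≫ g) i = perm g (perm f i) := rfl

theorem functor_ext {Y : Type w} [Category Y] {F G : Y ⥤ Sym X}
    (hc : ∀ a, (F.obj a).card = (G.obj a).card)
    (hv : ∀ a i, (F.obj a).val i = (G.obj a).val (Fin.cast (hc a) i))
    (hp : ∀ {a b} (f : a ⟶ b) i,
      ((perm (F.map f) i : Fin _) : ℕ) = perm (G.map f) (Fin.cast (hc a) i))
    (hf : ∀ {a b} (f : a ⟶ b) i, fam (F.map f) i ≍ fam (G.map f) (Fin.cast (hc a) i)) :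
    F = G := by
  refine Functor.hext (fun a => obj_ext (hc a) (hv a)) (fun a b f => ?_)
  have key : ∀ (p q p' q' : Sym X) (r : p ⟶ q) (r' : p' ⟶ q') (ep : p = p') (eq : q = q')
      (hc : p.card = p'.card) (_ : ∀ i, ((perm r i : Fin _) : ℕ) = perm r' (Fin.cast hc i))
      (_ : ∀ i, fam r i ≍ fam r' (Fin.cast hc i)), r ≍ r' := by
    rintro p q p' q' r r' rfl rfl hc h1 h2
    exact heq_of_eq (FamHom.ext_heq (fun i => Fin.ext (h1 i)) h2)
  exact key _ _ _ _ _ _ (obj_ext (hc a) (hv a)) (obj_ext (hc b) (hv b)) (hc a) (hp f) (hf f)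

/-- The functor `S f : S X ⥤ S Y` induced by a functor `f : X ⥤ Y`. -/
def map {Y : Type u} [Groupoid.{v} Y] (F : X ⥤ Y) : Sym X ⥤ Sym Y where
  obj a := ⟨a.card, fun i => F.obj (a.val i)⟩
  map {a b} f := ⟨perm (a := a) (b := b) f, fun i => F.map (fam (a := a) (b := b) f i)⟩
  map_id a := FamHom.ext_heq (fun _ => rfl) (fun i => by
    exact heq_of_eq (F.map_id (a.val i)))
  map_comp f g := FamHom.ext_heq (fun _ => rfl) (fun i => by
    exact heq_of_eq (F.map_comp (fam f i) (fam g (perm f i))))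

/-- The unit `X ⥤ S X`, the inclusion of the singleton families. -/
def unit (X : Type u) [Groupoid.{v} X] : X ⥤ Sym X where
  obj x := ⟨1, fun _ => x⟩
  map f := ⟨Equiv.refl _, fun _ => f⟩
  map_id _ := rfl
  map_comp _ _ := rfl

/-- The index set of the concatenation of a family of families, and its bijection with the sum
of the index sets, which puts the families one after the other. -/
abbrev sigmaEquiv (z : Sym (Sym X)) :
    Fin (∑ i, (z.val i).card) ≃ (i : Fin z.card) × Fin (z.val i).card :=
  finSigmaFinEquiv.symm

/-- The map between the total families of a map of families of families. -/
def sigmaHom {z z' : Sym (Sym X)} (f : z ⟶ z') :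
    FamHom (fun p : (i : Fin z.card) × Fin (z.val i).card => (z.val p.1).val p.2)
      (fun p : (i : Fin z'.card) × Fin (z'.val i).card => (z'.val p.1).val p.2) where
  perm := Equiv.sigmaCongr (perm f) (fun i => perm (fam f i))
  fam p := fam (fam f p.1) p.2

/-- The multiplication `S S X ⥤ S X`, the concatenation of families. -/
def mult (X : Type u) [Groupoid.{v} X] : Sym (Sym X) ⥤ Sym X where
  obj z := ⟨∑ i, (z.val i).card, fun k => (z.val (sigmaEquiv z k).1).val (sigmaEquiv z k).2⟩
  map {z z'} f := ((FamHom.reindex _ (sigmaEquiv z)).comp (sigmaHom f)).comp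
    (FamHom.reindex (fun p : (i : Fin z'.card) × Fin (z'.val i).card =>
      (z'.val p.1).val p.2) (sigmaEquiv z')).inv
  map_id z := by
    have : sigmaHom (𝟙 z) = FamHom.id _ := FamHom.ext_heq (fun _ => rfl) (fun _ => HEq.rfl)
    rw [this, FamHom.comp_id]
    exact FamHom.comp_inv _
  map_comp {z z' z''} f g := by
    have : sigmaHom (f ≫ g) = (sigmaHom f).comp (sigmaHom g) :=
      FamHom.ext_heq (fun _ => rfl) (fun _ => HEq.rfl)
    rw [this]
    change _ = FamHom.comp _ _
    simp only [FamHom.assoc]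
    congr 2
    rw [← FamHom.assoc, ← FamHom.assoc, FamHom.inv_comp, FamHom.id_comp]

theorem mult_perm {z z' : Sym (Sym X)} (f : z ⟶ z') (k : Fin ((mult X).obj z).card) :
    perm ((mult X).map f) k = (sigmaEquiv z').symm ⟨perm f (sigmaEquiv z k).1,
      perm (fam f (sigmaEquiv z k).1) (sigmaEquiv z k).2⟩ := rfl

theorem mult_fam {z z' : Sym (Sym X)} (f : z ⟶ z') (k : Fin ((mult X).obj z).card) :
    fam ((mult X).map f) k ≍ fam (fam f (sigmaEquiv z k).1) (sigmaEquiv z k).2 := by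
  refine (FamHom.comp_inv_reindex_fam _ _ _).trans ?_
  exact heq_of_eq (Category.id_comp (fam (fam f (sigmaEquiv z k).1) (sigmaEquiv z k).2))

end

theorem finSigma_lt {m : ℕ} {n : Fin m → ℕ} {p q : (i : Fin m) × Fin (n i)}
    (h : p.1 < q.1 ∨ p.1 = q.1 ∧ (p.2 : ℕ) < q.2) :
    finSigmaFinEquiv p < finSigmaFinEquiv q := by
  rw [Fin.lt_def, finSigmaFinEquiv_apply, finSigmaFinEquiv_apply]
  have key : ∀ a : Fin m, ∑ i : Fin (a : ℕ), n (Fin.castLE a.2.le i) =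
      ∑ i ∈ Finset.range a, (if h : i < m then n ⟨i, h⟩ else 0) := by
    intro a
    rw [← Fin.sum_univ_eq_sum_range]
    refine Finset.sum_congr rfl (fun i _ => ?_)
    rw [dif_pos (i.2.trans a.2)]
    rfl
  rw [key, key]
  rcases h with h | ⟨h, h'⟩
  · have h1 : Finset.range ((p.1 : ℕ) + 1) ⊆ Finset.range q.1 := by
      intro i hi
      have := Fin.lt_def.1 h
      simp only [Finset.mem_range] at hi ⊢
      omega
    have h2 := Finset.sum_le_sum_of_subset (f := fun i => if h : i < m then n ⟨i, h⟩ else 0) h1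
    rw [Finset.sum_range_succ, dif_pos p.1.2] at h2
    have := p.2.2
    simp only [Fin.eta] at h2
    omega
  · have h2 : (p.1 : ℕ) = q.1 := congrArg _ h
    simp only [h2]
    omega

theorem finSigma_symm_lt {m : ℕ} {n : Fin m → ℕ} {k l : Fin (∑ i, n i)} (h : k < l) :
    (finSigmaFinEquiv.symm k).1 < (finSigmaFinEquiv.symm l).1 ∨
      (finSigmaFinEquiv.symm k).1 = (finSigmaFinEquiv.symm l).1 ∧
      ((finSigmaFinEquiv.symm k).2 : ℕ) < (finSigmaFinEquiv.symm l).2 := by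
  rcases lt_trichotomy (finSigmaFinEquiv.symm k).1 (finSigmaFinEquiv.symm l).1 with h1 | h1 | h1
  · exact Or.inl h1
  · rcases lt_trichotomy ((finSigmaFinEquiv.symm k).2 : ℕ) (finSigmaFinEquiv.symm l).2
      with h2 | h2 | h2
    · exact Or.inr ⟨h1, h2⟩
    · have h3 : finSigmaFinEquiv.symm k = finSigmaFinEquiv.symm l := by
        generalize finSigmaFinEquiv.symm k = p at *
        generalize finSigmaFinEquiv.symm l = q at *
        obtain ⟨i, a⟩ := p
        obtain ⟨j, b⟩ := q
        obtain rfl : i = j := h1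
        exact congrArg (Sigma.mk i) (Fin.ext h2)
      exact absurd (finSigmaFinEquiv.symm.injective h3) h.ne
    · have := finSigma_lt (Or.inr ⟨h1.symm, h2⟩)
      simp only [Equiv.apply_symm_apply] at this
      exact absurd this h.asymm
  · have := finSigma_lt (Or.inl h1)
    simp only [Equiv.apply_symm_apply] at this
    exact absurd this h.asymm

/-- Strictly monotone bijections of finite ordinals are identities. -/
theorem val_eq_of_strictMono {a b : ℕ} (e : Fin a ≃ Fin b) (he : StrictMono e) (k : Fin a) :
    (e k : ℕ) = k :=
  Fin.coe_orderIso_apply (StrictMono.orderIsoOfSurjective e he e.surjective) k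

section Laws

variable (X : Type u) [Groupoid.{v} X]

theorem unit_mult : unit (Sym X) ⋙ mult X = 𝟭 (Sym X) := by
  have hc : ∀ z : Sym X, ∑ _i : Fin 1, z.card = z.card := fun z => by simp
  have hk : ∀ (z : Sym X) (k : Fin (∑ _i : Fin 1, z.card)),
      (sigmaEquiv ((unit (Sym X)).obj z) k).2 = Fin.cast (hc z) k := by
    intro z k
    refine Fin.ext ((finSigmaFinEquiv_one (n := fun _ => z.card)
      (sigmaEquiv ((unit (Sym X)).obj z) k)).symm.trans ?_)
    exact congrArg Fin.val ((sigmaEquiv ((unit (Sym X)).obj z)).symm_apply_apply k)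
  refine functor_ext hc (fun z k => ?_) (fun {z z'} f k => ?_) (fun {z z'} f k => ?_)
  · exact congrArg z.val (hk z k)
  · refine (finSigmaFinEquiv_one (n := fun _ => z'.card) _).trans ?_
    exact congrArg (fun i => (perm f i : ℕ)) (hk z k)
  · refine (mult_fam _ _).trans ?_
    exact FamHom.fam_congr f (hk z k)

theorem map_unit_mult : map (unit X) ⋙ mult X = 𝟭 (Sym X) := by
  have hc : ∀ z : Sym X, ∑ _i : Fin z.card, 1 = z.card := fun z => by simp
  have hk : ∀ (z : Sym X) (k : Fin (∑ _i : Fin z.card, 1)),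
      (sigmaEquiv ((map (unit X)).obj z) k).1 = Fin.cast (hc z) k := by
    intro z k
    refine Fin.ext ?_
    exact val_eq_of_strictMono
      ((sigmaEquiv ((map (unit X)).obj z)).trans (Equiv.sigmaUnique _ (fun _ => Fin 1)))
      (fun k l h => by
        rcases finSigma_symm_lt h with h1 | ⟨_, h1⟩
        · exact h1
        · exact absurd h1 (by
            have h2 := ((sigmaEquiv ((map (unit X)).obj z)) k).2.2
            have h3 := ((sigmaEquiv ((map (unit X)).obj z)) l).2.2
            change _ < 1 at h2
            change _ < 1 at h3
            change ¬ (((sigmaEquiv ((map (unit X)).obj z)) k).2 : ℕ) <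
              ((sigmaEquiv ((map (unit X)).obj z)) l).2
            omega)) k
  refine functor_ext hc (fun z k => ?_) (fun {z z'} f k => ?_) (fun {z z'} f k => ?_)
  · exact congrArg z.val (hk z k)
  · change ((sigmaEquiv ((map (unit X)).obj z')).symm _ : ℕ) = _
    refine (congrArg Fin.val (hk z' _)).symm.trans ?_
    rw [Equiv.apply_symm_apply]
    exact congrArg (fun i => (perm f i : ℕ)) (hk z k)
  · refine (mult_fam _ _).trans ?_
    exact FamHom.fam_congr f (hk z k)

variable {X}

theorem perm_heq {a b a' b' : Sym X} {r : a ⟶ b} {r' : a' ⟶ b'} (ha : a = a') (hb : b = b')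
    (h : r ≍ r') {i : Fin a.card} {i' : Fin a'.card} (hi : i ≍ i') :
    perm r i ≍ perm r' i' := by
  subst ha hb
  obtain rfl := eq_of_heq h
  obtain rfl := eq_of_heq hi
  rfl

theorem fam_heq {a b a' b' : Sym X} {r : a ⟶ b} {r' : a' ⟶ b'} (ha : a = a') (hb : b = b')
    (h : r ≍ r') {i : Fin a.card} {i' : Fin a'.card} (hi : i ≍ i') :
    fam r i ≍ fam r' i' := by
  subst ha hb
  obtain rfl := eq_of_heq h
  obtain rfl := eq_of_heq hi
  rfl

theorem mult_val_symm (z : Sym (Sym X)) (p : (i : Fin z.card) × Fin (z.val i).card) :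
    ((mult X).obj z).val ((sigmaEquiv z).symm p) = (z.val p.1).val p.2 := by
  change (z.val (sigmaEquiv z ((sigmaEquiv z).symm p)).1).val _ = _
  rw [Equiv.apply_symm_apply]

theorem mult_perm_symm {z z' : Sym (Sym X)} (f : z ⟶ z')
    (p : (i : Fin z.card) × Fin (z.val i).card) :
    perm ((mult X).map f) ((sigmaEquiv z).symm p) =
      (sigmaEquiv z').symm ⟨perm f p.1, perm (fam f p.1) p.2⟩ := by
  refine (mult_perm _ _).trans ?_
  rw [Equiv.apply_symm_apply]

theorem mult_fam_symm {z z' : Sym (Sym X)} (f : z ⟶ z')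
    (p : (i : Fin z.card) × Fin (z.val i).card) :
    fam ((mult X).map f) ((sigmaEquiv z).symm p) ≍ fam (fam f p.1) p.2 := by
  refine (mult_fam _ _).trans ?_
  rw [Equiv.apply_symm_apply]

variable (X)

/-- The comparison of the two ways of concatenating a family of families of families. -/
def assocEquiv (w : Sym (Sym (Sym X))) :
    Fin ((mult X).obj ((mult (Sym X)).obj w)).card ≃
      Fin ((mult X).obj ((map (mult X)).obj w)).card :=
  ((sigmaEquiv ((mult (Sym X)).obj w)).trans
    ((Equiv.sigmaCongrLeft (β := fun p : (i : Fin w.card) × Fin (w.val i).card =>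
      Fin ((w.val p.1).val p.2).card) (sigmaEquiv w)).trans
    ((Equiv.sigmaAssoc (fun (i : Fin w.card) (j : Fin (w.val i).card) =>
      Fin ((w.val i).val j).card)).trans
    (Equiv.sigmaCongrRight (fun i => (sigmaEquiv (w.val i)).symm))))).trans
    (sigmaEquiv ((map (mult X)).obj w)).symm

theorem assocEquiv_apply (w : Sym (Sym (Sym X)))
    (k : Fin ((mult X).obj ((mult (Sym X)).obj w)).card) :
    assocEquiv X w k = (sigmaEquiv ((map (mult X)).obj w)).symm
      ⟨(sigmaEquiv w (sigmaEquiv ((mult (Sym X)).obj w) k).1).1,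
        (sigmaEquiv (w.val (sigmaEquiv w (sigmaEquiv ((mult (Sym X)).obj w) k).1).1)).symm
        ⟨(sigmaEquiv w (sigmaEquiv ((mult (Sym X)).obj w) k).1).2,
          (sigmaEquiv ((mult (Sym X)).obj w) k).2⟩⟩ := rfl

theorem assocEquiv_strictMono (w : Sym (Sym (Sym X))) : StrictMono (assocEquiv X w) := by
  intro k l h
  rw [assocEquiv_apply, assocEquiv_apply]
  refine finSigma_lt ?_
  have key : ∀ {p q : (i : Fin w.card) × Fin (w.val i).card}
      (c : Fin ((w.val p.1).val p.2).card) (d : Fin ((w.val q.1).val q.2).card)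
      (_ : (p.1 < q.1 ∨ p.1 = q.1 ∧ (p.2 : ℕ) < q.2) ∨ p = q ∧ (c : ℕ) < d),
      p.1 < q.1 ∨ p.1 = q.1 ∧ ((sigmaEquiv (w.val p.1)).symm ⟨p.2, c⟩ : ℕ) <
        (sigmaEquiv (w.val q.1)).symm ⟨q.2, d⟩ := by
    rintro ⟨i, j⟩ ⟨i', j'⟩ c d h
    rcases h with (h | ⟨h, h'⟩) | ⟨h, h'⟩
    · exact Or.inl h
    · obtain rfl : i = i' := h
      exact Or.inr ⟨rfl, finSigma_lt (Or.inl h')⟩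
    · cases h
      exact Or.inr ⟨rfl, finSigma_lt (Or.inr ⟨rfl, h'⟩)⟩
  refine key _ _ ?_
  rcases finSigma_symm_lt h with h1 | ⟨h1, h2⟩
  · exact Or.inl (finSigma_symm_lt h1)
  · exact Or.inr ⟨congrArg (sigmaEquiv w) h1, h2⟩

theorem mult_mult : mult (Sym X) ⋙ mult X = map (mult X) ⋙ mult X := by
  have hc : ∀ w : Sym (Sym (Sym X)), ((mult X).obj ((mult (Sym X)).obj w)).card =
      ((mult X).obj ((map (mult X)).obj w)).card := fun w => by
    simpa using Fintype.card_congr (assocEquiv X w)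
  have hk : ∀ w k, Fin.cast (hc w) k = assocEquiv X w k := fun w k =>
    Fin.ext (val_eq_of_strictMono _ (assocEquiv_strictMono X w) k).symm
  refine functor_ext hc (fun w k => ?_) (fun {w w'} f k => ?_) (fun {w w'} f k => ?_)
  · rw [hk, assocEquiv_apply]
    refine Eq.trans ?_ (mult_val_symm ((map (mult X)).obj w) _).symm
    let q := sigmaEquiv ((mult (Sym X)).obj w) k
    let r := sigmaEquiv w q.1
    exact (mult_val_symm (w.val r.1) ⟨r.2, q.2⟩).symm
  · rw [hk, assocEquiv_apply]
    refine Eq.trans ?_ (congrArg Fin.val (mult_perm_symm ((map (mult X)).map f) _)).symm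
    refine (val_eq_of_strictMono _ (assocEquiv_strictMono X w') _).symm.trans ?_
    rw [assocEquiv_apply]
    refine congrArg Fin.val (congrArg (sigmaEquiv ((map (mult X)).obj w')).symm ?_)
    let q := sigmaEquiv ((mult (Sym X)).obj w) k
    let r := sigmaEquiv w q.1
    have h1 : sigmaEquiv ((mult (Sym X)).obj w')
        (perm ((mult X).map ((mult (Sym X)).map f)) k) =
        ⟨perm ((mult (Sym X)).map f) q.1, perm (fam ((mult (Sym X)).map f) q.1) q.2⟩ :=
      Equiv.apply_symm_apply _ _
    have h2 : sigmaEquiv w' (perm ((mult (Sym X)).map f) q.1) =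
        ⟨perm f r.1, perm (fam f r.1) r.2⟩ := Equiv.apply_symm_apply _ _
    have key : ∀ (s t : (p : (i : Fin w'.card) × Fin (w'.val i).card) ×
        Fin ((w'.val p.1).val p.2).card) (_ : s = t),
        (⟨s.1.1, (sigmaEquiv (w'.val s.1.1)).symm ⟨s.1.2, s.2⟩⟩ :
          (i : Fin w'.card) × Fin (∑ j, ((w'.val i).val j).card)) =
        ⟨t.1.1, (sigmaEquiv (w'.val t.1.1)).symm ⟨t.1.2, t.2⟩⟩ := by
      rintro s t rfl
      rfl
    let Q := sigmaEquiv ((mult (Sym X)).obj w') (perm ((mult X).map ((mult (Sym X)).map f)) k)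
    refine (key ⟨sigmaEquiv w' Q.1, Q.2⟩
      ⟨⟨perm f r.1, perm (fam f r.1) r.2⟩, perm (fam (fam f r.1) r.2) q.2⟩ ?_).trans ?_
    · refine Sigma.ext ?_ ?_
      · exact (congrArg (fun t => sigmaEquiv w' t.1) h1).trans h2
      · have h3 : Q.2 ≍ perm (fam ((mult (Sym X)).map f) q.1) q.2 := by
          change Sigma.snd (sigmaEquiv ((mult (Sym X)).obj w') _) ≍ _
          rw [h1]
        refine h3.trans ?_
        exact perm_heq rfl (mult_val_symm w' _) (mult_fam f _) HEq.rfl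
    · refine Sigma.ext rfl (heq_of_eq ?_)
      exact (mult_perm_symm (fam f r.1) ⟨r.2, q.2⟩).symm
  · rw [hk, assocEquiv_apply]
    let q := sigmaEquiv ((mult (Sym X)).obj w) k
    let r := sigmaEquiv w q.1
    refine HEq.trans ?_ (mult_fam_symm ((map (mult X)).map f) _).symm
    refine HEq.trans ?_ (mult_fam_symm (fam f r.1) ⟨r.2, q.2⟩).symm
    refine (mult_fam ((mult (Sym X)).map f) k).trans ?_
    refine fam_heq rfl ?_ (mult_fam f _) HEq.rfl
    exact mult_val_symm w' _

theorem unit_naturality {Y : Type u} [Groupoid.{v} Y] (F : X ⥤ Y) :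
    F ⋙ unit Y = unit X ⋙ map F := rfl

theorem mult_naturality {Y : Type u} [Groupoid.{v} Y] (F : X ⥤ Y) :
    map (map F) ⋙ mult Y = mult X ⋙ map F := by
  refine functor_ext (fun a => rfl) (fun a i => rfl) (fun f i => rfl) (fun {a b} f i => ?_)
  refine (mult_fam _ _).trans ?_
  have key : ∀ {p q p' q' : X} (r : p ⟶ q) (r' : p' ⟶ q') (_ : p = p') (_ : q = q')
    (_ : r ≍ r'), F.map r ≍ F.map r' := by
    rintro p q p' q' r r' rfl rfl h
    rw [eq_of_heq h]
  refine key _ _ ?_ ?_ (mult_fam f i).symm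
  · rfl
  · exact (mult_val_symm b ⟨perm f (sigmaEquiv a i).1, perm (fam f (sigmaEquiv a i).1)
      (sigmaEquiv a i).2⟩).symm

end Laws

end Sym

/-- The symmetric monoidal category monad `S` on the category of groupoids,
`S X = ∫^{n ∈ 𝔹} Map(n, X)`. -/
def symMonad : Monad Grpd.{v, u} where
  obj X := Grpd.of (Sym X)
  map F := Sym.map F
  map_id _ := rfl
  map_comp _ _ := rfl
  η :=
    { app := fun X => Sym.unit X
      naturality := fun _ _ F => Sym.unit_naturality _ F }
  μ :=
    { app := fun X => Sym.mult X
      naturality := fun _ _ F => Sym.mult_naturality _ F }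
  assoc X := (Sym.mult_mult X).symm
  left_unit X := Sym.unit_mult X
  right_unit X := Sym.map_unit_mult X

/-! ### Polynomial functors over `S`, and operads -/

/-- A functor is a discrete fibration if every arrow of the base into the image of an object
has a unique lift with that codomain. -/
def IsDiscreteFibration {E : Type u} [Category.{v} E] {B : Type u'} [Category.{v'} B]
    (p : E ⥤ B) : Prop :=
  ∀ (e : E) (b : B) (g : b ⟶ p.obj e), ∃! x : (e' : E) × (e' ⟶ e), p.IsHomLift g x.2

/-- A polynomial diagram of groupoids `I ← E → B → I`, with `I` a set, together with a cartesian
map of diagrams to `1 ← 𝔹' → 𝔹 → 1`. -/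
structure PolyOver (I : Type u) where
  /-- The groupoid of operations. -/
  B : Grpd.{u, u}
  /-- The map `B → 𝔹`. -/
  arity : B ⥤ FinBij
  /-- The map `E → I`, where `E = B ×_𝔹 𝔹'` is the groupoid of operations `b` with a marked input
  slot `i ∈ {0, …, n - 1}`, with `n` the arity of `b`. -/
  source : (arity ⋙ FinBij.toType).Elements ⥤ Discrete I
  /-- The map `B → I`. -/
  target : B ⥤ Discrete I

/-- The structure map of an object of the strict slice `Grpd / I`. -/
abbrev colour {I : Type u} (X : Over (Grpd.of (Discrete I))) : X.left ⥤ Discrete I := X.hom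

namespace PolyOver

variable {I : Type u} (P : PolyOver I)

/-- The objects of `t_! p_* s^* X`: an operation `b` and a map over `I` from the fibre of `E → B`
over `b`, which is the set of input slots of `b`, to `X`. -/
structure Obj (X : Over (Grpd.of (Discrete I))) : Type u where
  oper : P.B
  val : Fin (P.arity.obj oper).card → X.left
  col : ∀ i, (colour X).obj (val i) = P.source.obj ⟨oper, i⟩

/-- The arrows of `t_! p_* s^* X`: an arrow of `B` and, over the bijection that it induces between
the sets of input slots, a family of arrows of `X`. (These lie over the arrows of `I` given by
`E → I` automatically, since `I` is discrete.) -/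
structure Hom {X : Over (Grpd.of (Discrete I))} (a b : P.Obj X) : Type u where
  oper : a.oper ⟶ b.oper
  fam : FamHom a.val b.val
  perm_eq : fam.perm = P.arity.map oper

variable {P} in
theorem Hom.ext' {X : Over (Grpd.of (Discrete I))} {a b : P.Obj X} {f g : P.Hom a b}
    (h : f.oper = g.oper) (h' : f.fam = g.fam) : f = g := by
  cases f
  cases g
  cases h
  cases h'
  rfl

instance (X : Over (Grpd.of (Discrete I))) : Groupoid.{u} (P.Obj X) where
  Hom a b := P.Hom a b
  id a := ⟨𝟙 a.oper, FamHom.id a.val, (P.arity.map_id a.oper).symm⟩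
  comp f g := ⟨f.oper ≫ g.oper, f.fam.comp g.fam, by
    rw [P.arity.map_comp, ← f.perm_eq, ← g.perm_eq]
    rfl⟩
  id_comp f := Hom.ext' (Category.id_comp _) (FamHom.id_comp _)
  comp_id f := Hom.ext' (Category.comp_id _) (FamHom.comp_id _)
  assoc f g h := Hom.ext' (Category.assoc _ _ _) (FamHom.assoc _ _ _)
  inv f := ⟨Groupoid.inv f.oper, f.fam.inv, by
    rw [Groupoid.inv_eq_inv, Functor.map_inv, ← Groupoid.inv_eq_inv, ← f.perm_eq]
    rfl⟩
  inv_comp f := Hom.ext' (Groupoid.inv_comp _) (FamHom.inv_comp _)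
  comp_inv f := Hom.ext' (Groupoid.comp_inv _) (FamHom.comp_inv _)

/-- The projection `t_! p_* s^* X → B`. -/
def toB (X : Over (Grpd.of (Discrete I))) : P.Obj X ⥤ P.B where
  obj a := a.oper
  map {a b} f := (show P.Hom a b from f).oper

/-- The action of `t_! p_* s^*` on the maps of `Grpd / I`. -/
def mapObj {X Y : Over (Grpd.of (Discrete I))} (F : X ⟶ Y) : P.Obj X ⥤ P.Obj Y where
  obj a := ⟨a.oper, fun i => (show X.left ⥤ Y.left from F.left).obj (a.val i), fun i =>
    (Functor.congr_obj (Over.w F) (a.val i)).trans (a.col i)⟩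
  map {a b} f :=
    have f : P.Hom a b := f
    ⟨f.oper, ⟨f.fam.perm, fun i => (show X.left ⥤ Y.left from F.left).map (f.fam.fam i)⟩, f.perm_eq⟩
  map_id a := Hom.ext' rfl (FamHom.ext_heq (fun _ => rfl) (fun i =>
    heq_of_eq ((show X.left ⥤ Y.left from F.left).map_id (a.val i))))
  map_comp f _ := Hom.ext' rfl (FamHom.ext_heq (fun _ => rfl) (fun i =>
    heq_of_eq ((show X.left ⥤ Y.left from F.left).map_comp (f.fam.fam i) _)))

/-- The polynomial functor `t_! p_* s^* : Grpd / I ⥤ Grpd / I`. -/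
def functor : Over (Grpd.of (Discrete I)) ⥤ Over (Grpd.of (Discrete I)) where
  obj X := Over.mk (Y := Grpd.of (P.Obj X)) (P.toB X ⋙ P.target)
  map F := Over.homMk (P.mapObj F) rfl
  map_id _ := rfl
  map_comp _ _ := by
    ext : 1
    rfl

/-- The natural transformation `φ : F_! R ⟶ S F_!` induced by the cartesian map of polynomial
diagrams, where `F` is the map `I → 1` and `F_! : Grpd / I ⥤ Grpd` is the forgetful functor. -/
def phi : P.functor ⋙ Over.forget (Grpd.of (Discrete I)) ⟶
    Over.forget (Grpd.of (Discrete I)) ⋙ symMonad.{u, u}.toFunctor where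
  app X :=
    { obj := fun a => ⟨(P.arity.obj a.oper).card, a.val⟩
      map := fun f => f.fam
      map_id := fun _ => rfl
      map_comp := fun _ _ => rfl : P.Obj X ⥤ Sym X.left }
  naturality _ _ _ := rfl

end PolyOver

/-- A coloured symmetric operad with set of colours `I`, as a polynomial monad cartesian over the
symmetric monoidal category monad: a polynomial diagram `I ← E → B → I` cartesian over
`1 ← 𝔹' → 𝔹 → 1`, with `B → 𝔹` a discrete fibration, together with a monad structure on its
polynomial functor `R` such that the induced `φ : F_! R ⟶ S F_!` is compatible with the units
and the multiplications. -/
structure Operad (I : Type u) extends PolyOver I where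
  isDiscreteFibration : IsDiscreteFibration arity
  η : 𝟭 (Over (Grpd.of (Discrete I))) ⟶ toPolyOver.functor
  μ : toPolyOver.functor ⋙ toPolyOver.functor ⟶ toPolyOver.functor
  assoc : ∀ X, toPolyOver.functor.map (μ.app X) ≫ μ.app X =
    μ.app (toPolyOver.functor.obj X) ≫ μ.app X
  left_unit : ∀ X, η.app (toPolyOver.functor.obj X) ≫ μ.app X = 𝟙 _
  right_unit : ∀ X, toPolyOver.functor.map (η.app X) ≫ μ.app X = 𝟙 _
  phi_unit : ∀ X, (η.app X).left ≫ toPolyOver.phi.app X = symMonad.η.app X.left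
  phi_mult : ∀ X, (μ.app X).left ≫ toPolyOver.phi.app X =
    toPolyOver.phi.app (toPolyOver.functor.obj X) ≫ symMonad.map (toPolyOver.phi.app X) ≫
      symMonad.μ.app X.left

/-! ### Simplicial objects by faces and degeneracies, and the relative bar construction -/

/-- A simplicial object, given by its face maps `d_i` and degeneracy maps `s_i` subject to the
simplicial identities. -/
structure SimplicialObj (C : Type u) [Category.{v} C] where
  obj : ℕ → C
  d : ∀ n, Fin (n + 2) → (obj (n + 1) ⟶ obj n)
  s : ∀ n, Fin (n + 1) → (obj n ⟶ obj (n + 1))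
  d_comp_d : ∀ n (i j : Fin (n + 2)), i ≤ j →
    d (n + 1) j.succ ≫ d n i = d (n + 1) i.castSucc ≫ d n j
  s_comp_d_of_le : ∀ n (i : Fin (n + 2)) (j : Fin (n + 1)), i ≤ j.castSucc →
    s (n + 1) j.succ ≫ d (n + 1) i.castSucc = d n i ≫ s n j
  s_comp_d_self : ∀ n (i : Fin (n + 1)), s n i ≫ d n i.castSucc = 𝟙 _
  s_comp_d_succ : ∀ n (i : Fin (n + 1)), s n i ≫ d n i.succ = 𝟙 _
  s_comp_d_of_gt : ∀ n (i : Fin (n + 2)) (j : Fin (n + 1)), j.castSucc < i →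
    s (n + 1) j.castSucc ≫ d (n + 1) i.succ = d n i ≫ s n j
  s_comp_s : ∀ n (i j : Fin (n + 1)), i ≤ j →
    s n j ≫ s (n + 1) i.castSucc = s n i ≫ s (n + 1) j.succ

/-- A monad opfunctor from a monad `R` on `C` to a monad `S` on `D`: a functor `F : C ⥤ D` and a
natural transformation `φ : F R ⟶ S F` compatible with the units and the multiplications. -/
structure MonadOpfunctor {C : Type u} [Category.{v} C] {D : Type u'} [Category.{v'} D]
    (R : Monad C) (S : Monad D) where
  F : C ⥤ D
  φ : R.toFunctor ⋙ F ⟶ F ⋙ S.toFunctor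
  unit : ∀ X, F.map (R.η.app X) ≫ φ.app X = S.η.app (F.obj X)
  mult : ∀ X, F.map (R.μ.app X) ≫ φ.app X =
    φ.app (R.obj X) ≫ S.map (φ.app X) ≫ S.μ.app (F.obj X)

theorem map_sq {C : Type u} [Category.{v} C] {D : Type u'} [Category.{v'} D] (F : C ⥤ D)
    {W X Y Z : C} {f : W ⟶ X} {g : X ⟶ Z} {f' : W ⟶ Y} {g' : Y ⟶ Z} (h : f ≫ g = f' ≫ g') :
    F.map f ≫ F.map g = F.map f' ≫ F.map g' := by
  rw [← F.map_comp, h, F.map_comp]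

theorem map_retract {C : Type u} [Category.{v} C] {D : Type u'} [Category.{v'} D] (F : C ⥤ D)
    {X Y : C} {f : X ⟶ Y} {g : Y ⟶ X} (h : f ≫ g = 𝟙 X) : F.map f ≫ F.map g = 𝟙 (F.obj X) := by
  rw [← F.map_comp, h, F.map_id]

section Bar

variable {C : Type u} [Category.{v} C] {R : Monad C} (A : R.Algebra)

/-- The objects `R^n A`. -/
def iter : ℕ → C
  | 0 => A.A
  | n + 1 => R.obj (iter n)

/-- The map `μ_{R^{n-1} A} : R^{n+1} A ⟶ R^n A`, with the convention that `μ_{R^{-1} A}` is the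
action `α : R A ⟶ A`. -/
def lastFace : ∀ n, iter A (n + 1) ⟶ iter A n
  | 0 => A.a
  | n + 1 => R.μ.app (iter A n)

/-- The face maps `d_k = R^{n-k} μ_{R^{k-1} A} : R^{n+1} A ⟶ R^n A`, for `k ≤ n`. -/
def face : ∀ (n _k : ℕ), iter A (n + 1) ⟶ iter A n
  | 0, _ => lastFace A 0
  | n + 1, k => if k = n + 1 then lastFace A (n + 1) else R.map (face n k)

/-- The degeneracy maps `s_k = R^{n-k} η_{R^k A} : R^n A ⟶ R^{n+1} A`, for `k ≤ n`. -/
def degen : ∀ (n _k : ℕ), iter A n ⟶ iter A (n + 1)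
  | 0, _ => R.η.app A.A
  | n + 1, k => if k = n + 1 then R.η.app (iter A (n + 1)) else R.map (degen n k)

theorem iter_succ (n : ℕ) : iter A (n + 1) = R.obj (iter A n) := rfl

theorem face_last (n : ℕ) : face A n n = lastFace A n := by
  cases n with
  | zero => rfl
  | succ n => exact if_pos rfl

theorem face_of_le {n k : ℕ} (h : k ≤ n) : face A (n + 1) k = R.map (face A n k) :=
  if_neg (by omega)

theorem degen_last (n : ℕ) : degen A n n = R.η.app (iter A n) := by
  cases n with
  | zero => rfl
  | succ n => exact if_pos rfl

theorem degen_of_le {n k : ℕ} (h : k ≤ n) : degen A (n + 1) k = R.map (degen A n k) :=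
  if_neg (by omega)

theorem eta_nat {X Y : C} (f : X ⟶ Y) : R.η.app X ≫ R.map f = f ≫ R.η.app Y :=
  (R.η.naturality f).symm

theorem face_comp_face : ∀ (n i j : ℕ) (_ : i ≤ j) (_ : j ≤ n),
    face A (n + 1) (j + 1) ≫ face A n i = face A (n + 1) i ≫ face A n j := by
  intro n
  induction n with
  | zero =>
    intro i j hi hj
    obtain rfl : j = 0 := by omega
    obtain rfl : i = 0 := by omega
    exact A.assoc
  | succ n ih =>
    intro i j hi hj
    rcases Nat.lt_or_ge n j with h | h
    · obtain rfl : j = n + 1 := by omega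
      rw [face_last, face_last]
      rcases Nat.lt_or_ge n i with h' | h'
      · obtain rfl : i = n + 1 := by omega
        rw [face_of_le A le_rfl, face_last]
        exact (R.assoc _).symm
      · rw [face_of_le A (n := n + 1) (k := i) (by omega), face_of_le A h']
        exact (R.μ.naturality _).symm
    · rw [face_of_le A (k := j + 1) (by omega), face_of_le A (n := n) (k := i) (by omega),
        face_of_le A (n := n + 1) (k := i) (by omega), face_of_le A h]
      exact map_sq R.toFunctor (ih i j hi h)

theorem degen_comp_face_of_le : ∀ (n i j : ℕ) (_ : i ≤ j) (_ : j ≤ n),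
    degen A (n + 1) (j + 1) ≫ face A (n + 1) i = face A n i ≫ degen A n j := by
  intro n
  induction n with
  | zero =>
    intro i j hi hj
    obtain rfl : j = 0 := by omega
    obtain rfl : i = 0 := by omega
    rw [degen_last, degen_last, face_of_le A le_rfl]
    exact eta_nat _
  | succ n ih =>
    intro i j hi hj
    rcases Nat.lt_or_ge n j with h | h
    · obtain rfl : j = n + 1 := by omega
      rw [degen_last, degen_last, face_of_le A (k := i) (by omega)]
      exact eta_nat _
    · rw [degen_of_le A (k := j + 1) (by omega), face_of_le A (n := n) (k := i) (by omega),
        face_of_le A (n := n + 1) (k := i) (by omega), degen_of_le A h]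
      exact map_sq R.toFunctor (ih i j hi h)

theorem degen_comp_face_self : ∀ (n i : ℕ) (_ : i ≤ n),
    degen A n i ≫ face A n i = 𝟙 _ := by
  intro n
  induction n with
  | zero =>
    intro i hi
    obtain rfl : i = 0 := by omega
    exact A.unit
  | succ n ih =>
    intro i hi
    rcases Nat.lt_or_ge n i with h | h
    · obtain rfl : i = n + 1 := by omega
      rw [degen_last, face_last]
      exact R.left_unit _
    · rw [degen_of_le A h, face_of_le A h]
      exact map_retract R.toFunctor (ih i h)

theorem degen_comp_face_succ : ∀ (n i : ℕ) (_ : i + 1 ≤ n),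
    degen A n i ≫ face A n (i + 1) = 𝟙 _ := by
  intro n
  induction n with
  | zero =>
    intro i hi
    omega
  | succ n ih =>
    intro i hi
    rcases Nat.lt_or_ge n (i + 1) with h | h
    · obtain rfl : i = n := by omega
      rw [degen_of_le A le_rfl, degen_last, face_last]
      exact R.right_unit _
    · rw [degen_of_le A (by omega), face_of_le A h]
      exact map_retract R.toFunctor (ih i h)

theorem degen_comp_face_of_gt : ∀ (n i j : ℕ) (_ : j < i) (_ : i ≤ n),
    degen A (n + 1) j ≫ face A (n + 1) (i + 1) = face A n i ≫ degen A n j := by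
  intro n
  induction n with
  | zero =>
    intro i j hi hj
    omega
  | succ n ih =>
    intro i j hi hj
    rcases Nat.lt_or_ge n i with h | h
    · obtain rfl : i = n + 1 := by omega
      rw [face_last, face_last, degen_of_le A (n := n + 1) (by omega), degen_of_le A (n := n)
        (by omega)]
      exact R.μ.naturality _
    · rw [face_of_le A (k := i + 1) (by omega), face_of_le A h,
        degen_of_le A (n := n + 1) (by omega)]
      refine (map_sq R.toFunctor (ih i j hi h)).trans ?_
      exact congrArg (fun t => R.map (face A n i) ≫ t) (degen_of_le A (by omega)).symm

theorem degen_comp_degen : ∀ (n i j : ℕ) (_ : i ≤ j) (_ : j ≤ n),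
    degen A n j ≫ degen A (n + 1) i = degen A n i ≫ degen A (n + 1) (j + 1) := by
  intro n
  induction n with
  | zero =>
    intro i j hi hj
    obtain rfl : j = 0 := by omega
    obtain rfl : i = 0 := by omega
    rw [degen_of_le A le_rfl, degen_last, degen_last]
    exact eta_nat _
  | succ n ih =>
    intro i j hi hj
    rcases Nat.lt_or_ge n j with h | h
    · obtain rfl : j = n + 1 := by omega
      rw [degen_last, degen_last, degen_of_le A (n := n + 1) (by omega)]
      exact eta_nat _
    · rw [degen_of_le A (n := n + 1) (k := i) (by omega), degen_of_le A h,
        degen_of_le A (n := n + 1) (k := j + 1) (by omega)]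
      refine (map_sq R.toFunctor (ih i j hi h)).trans ?_
      exact congrArg (fun t => t ≫ R.map (degen A (n + 1) (j + 1)))
        (degen_of_le A (by omega)).symm

end Bar

namespace MonadOpfunctor

variable {C : Type u} [Category.{v} C] {D : Type u'} [Category.{v'} D]
  {R : Monad C} {S : Monad D} (Φ : MonadOpfunctor R S)

/-- The map `μ^S ∘ S φ : S F R X ⟶ S F X`. -/
def top (X : C) : S.obj (Φ.F.obj (R.obj X)) ⟶ S.obj (Φ.F.obj X) :=
  S.map (Φ.φ.app X) ≫ S.μ.app (Φ.F.obj X)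

theorem top_naturality {X Y : C} (f : X ⟶ Y) :
    S.map (Φ.F.map (R.map f)) ≫ Φ.top Y = Φ.top X ≫ S.map (Φ.F.map f) := by
  have h : Φ.F.map (R.map f) ≫ Φ.φ.app Y = Φ.φ.app X ≫ S.map (Φ.F.map f) :=
    Φ.φ.naturality f
  rw [top, top, ← Category.assoc, ← S.map_comp, h, S.map_comp, Category.assoc,
    Category.assoc]
  exact congrArg (fun t => S.map (Φ.φ.app X) ≫ t) (S.μ.naturality (Φ.F.map f))

theorem unit_top (X : C) : S.map (Φ.F.map (R.η.app X)) ≫ Φ.top X = 𝟙 _ := by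
  rw [top, ← Category.assoc, ← S.map_comp, Φ.unit]
  exact S.right_unit _

theorem mult_top (X : C) :
    S.map (Φ.F.map (R.μ.app X)) ≫ Φ.top X = Φ.top (R.obj X) ≫ Φ.top X := by
  rw [top, top, ← Category.assoc, ← S.map_comp, Φ.mult, S.map_comp, S.map_comp,
    Category.assoc, Category.assoc, Category.assoc, S.assoc]
  have h : S.map (S.map (Φ.φ.app X)) ≫ S.μ.app (S.obj (Φ.F.obj X)) =
    S.μ.app (Φ.F.obj (R.obj X)) ≫ S.map (Φ.φ.app X) := S.μ.naturality _
  rw [← Category.assoc (S.map (S.map _)), h, Category.assoc]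

variable (A : R.Algebra)

/-- The objects `S F R^n A`. -/
def barObj (n : ℕ) : D := S.obj (Φ.F.obj (iter A n))

/-- The face maps of the relative bar construction: `S F` applied to the face map `d_i` of
`R^• A` for `i ≤ n`, and `μ^S ∘ S φ` for `i = n + 1`. -/
def barFace (n i : ℕ) : Φ.barObj A (n + 1) ⟶ Φ.barObj A n :=
  if i = n + 1 then Φ.top (iter A n) else S.map (Φ.F.map (face A n i))

/-- The degeneracy maps of the relative bar construction. -/
def barDegen (n i : ℕ) : Φ.barObj A n ⟶ Φ.barObj A (n + 1) := S.map (Φ.F.map (degen A n i))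

theorem barFace_top (n : ℕ) : Φ.barFace A n (n + 1) = Φ.top (iter A n) := if_pos rfl

theorem barFace_of_le {n i : ℕ} (h : i ≤ n) :
    Φ.barFace A n i = S.map (Φ.F.map (face A n i)) := if_neg (by omega)

/-- The relative bar construction `S F R^• A`. -/
def bar : SimplicialObj D where
  obj := Φ.barObj A
  d n i := Φ.barFace A n i
  s n i := Φ.barDegen A n i
  d_comp_d n i j h := by
    obtain ⟨i, hi⟩ := i
    obtain ⟨j, hj⟩ := j
    replace h : i ≤ j := h
    simp only [Fin.succ_mk, Fin.castSucc_mk]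
    rcases Nat.lt_or_ge n j with h1 | h1
    · obtain rfl : j = n + 1 := by omega
      rw [barFace_top, barFace_top, barFace_of_le Φ A (n := n + 1) (by omega)]
      rcases Nat.lt_or_ge n i with h2 | h2
      · obtain rfl : i = n + 1 := by omega
        rw [barFace_top, face_last]
        exact (Φ.mult_top _).symm
      · rw [barFace_of_le Φ A h2, face_of_le A h2]
        exact (Φ.top_naturality _).symm
    · rw [barFace_of_le Φ A (by omega), barFace_of_le Φ A (by omega),
        barFace_of_le Φ A (by omega), barFace_of_le Φ A (by omega)]
      exact map_sq (Φ.F ⋙ S.toFunctor) (face_comp_face A n i j h h1)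
  s_comp_d_of_le n i j h := by
    obtain ⟨i, hi⟩ := i
    obtain ⟨j, hj⟩ := j
    replace h : i ≤ j := h
    simp only [Fin.succ_mk, Fin.castSucc_mk]
    rw [barFace_of_le Φ A (by omega), barFace_of_le Φ A (by omega), barDegen, barDegen]
    exact map_sq (Φ.F ⋙ S.toFunctor) (degen_comp_face_of_le A n i j h (by omega))
  s_comp_d_self n i := by
    obtain ⟨i, hi⟩ := i
    simp only [Fin.castSucc_mk]
    rw [barFace_of_le Φ A (by omega), barDegen]
    exact map_retract (Φ.F ⋙ S.toFunctor) (degen_comp_face_self A n i (by omega))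
  s_comp_d_succ n i := by
    obtain ⟨i, hi⟩ := i
    simp only [Fin.succ_mk]
    rcases Nat.lt_or_ge n (i + 1) with h1 | h1
    · obtain rfl : i = n := by omega
      rw [barFace_top, barDegen, degen_last]
      exact Φ.unit_top _
    · rw [barFace_of_le Φ A h1, barDegen]
      exact map_retract (Φ.F ⋙ S.toFunctor) (degen_comp_face_succ A n i h1)
  s_comp_d_of_gt n i j h := by
    obtain ⟨i, hi⟩ := i
    obtain ⟨j, hj⟩ := j
    replace h : j < i := h
    simp only [Fin.succ_mk, Fin.castSucc_mk]
    rcases Nat.lt_or_ge n i with h1 | h1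
    · obtain rfl : i = n + 1 := by omega
      rw [barFace_top, barFace_top, barDegen, barDegen, degen_of_le A (by omega)]
      exact Φ.top_naturality _
    · rw [barFace_of_le Φ A (by omega), barFace_of_le Φ A (by omega), barDegen, barDegen]
      exact map_sq (Φ.F ⋙ S.toFunctor) (degen_comp_face_of_gt A n i j h h1)
  s_comp_s n i j h := by
    obtain ⟨i, hi⟩ := i
    obtain ⟨j, hj⟩ := j
    replace h : i ≤ j := h
    simp only [Fin.succ_mk, Fin.castSucc_mk]
    rw [barDegen, barDegen, barDegen, barDegen]
    exact map_sq (Φ.F ⋙ S.toFunctor) (degen_comp_degen A n i j h (by omega))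

end MonadOpfunctor

/-! ### Segal groupoids -/

/-- The canonical functor from the corner of a strictly commutative square of groupoids to the
homotopy pullback of the cospan. -/
def toHomotopyPullback {P X Y Z : Grpd.{v, u}} {fst : P ⟶ X} {snd : P ⟶ Y} {f : X ⟶ Z}
    {g : Y ⟶ Z} (w : fst ≫ f = snd ≫ g) :
    P ⥤ CategoricalPullback (show X ⥤ Z from f) (show Y ⥤ Z from g) where
  obj p := ⟨(show P ⥤ X from fst).obj p, (show P ⥤ Y from snd).obj p,
    eqToIso (Functor.congr_obj w p)⟩
  map h := ⟨(show P ⥤ X from fst).map h, (show P ⥤ Y from snd).map h, by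
    have hw := Functor.congr_hom w h
    change (show X ⥤ Z from f).map ((show P ⥤ X from fst).map h) = _ at hw
    rw [hw]
    simp
    rfl⟩
  map_id p := CategoricalPullback.hom_ext ((show P ⥤ X from fst).map_id p)
    ((show P ⥤ Y from snd).map_id p)
  map_comp h k := CategoricalPullback.hom_ext ((show P ⥤ X from fst).map_comp h k)
    ((show P ⥤ Y from snd).map_comp h k)

/-- A square of groupoids is a homotopy pullback if it commutes strictly and the canonical functor
from its corner to the homotopy pullback of the cospan is an equivalence. -/
def IsHomotopyPullback {P X Y Z : Grpd.{v, u}} (fst : P ⟶ X) (snd : P ⟶ Y) (f : X ⟶ Z)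
    (g : Y ⟶ Z) : Prop :=
  ∃ w : fst ≫ f = snd ≫ g, (toHomotopyPullback w).IsEquivalence

namespace SimplicialObj

/-- A simplicial object is a (strict) category object if all the squares formed by
`d_0, d_{n+2} : D_{n+2} ⟶ D_{n+1}` and `d_{n+1}, d_0 : D_{n+1} ⟶ D_n` are strict pullbacks. -/
def IsCategoryObject {C : Type u} [Category.{v} C] (D : SimplicialObj C) : Prop :=
  ∀ n, IsPullback (D.d (n + 1) 0) (D.d (n + 1) (Fin.last _)) (D.d n (Fin.last _)) (D.d n 0)

/-- A simplicial groupoid is a Segal groupoid if all the squares formed by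
`d_0, d_{n+2} : D_{n+2} ⟶ D_{n+1}` and `d_{n+1}, d_0 : D_{n+1} ⟶ D_n` are homotopy pullbacks. -/
def IsSegal (D : SimplicialObj Grpd.{v, u}) : Prop :=
  ∀ n, IsHomotopyPullback (D.d (n + 1) 0) (D.d (n + 1) (Fin.last _)) (D.d n (Fin.last _)) (D.d n 0)

end SimplicialObj

namespace Operad

variable {I : Type u} (O : Operad I)

/-- The monad `R` on `Grpd / I`. -/
def monad : Monad (Over (Grpd.of (Discrete I))) where
  toFunctor := O.toPolyOver.functor
  η := O.η
  μ := O.μ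
  assoc := O.assoc
  left_unit := O.left_unit
  right_unit := O.right_unit

/-- The functor `F_! : Grpd / I ⥤ Grpd` and the natural transformation `φ : F_! R ⟶ S F_!`. -/
def opfunctor : MonadOpfunctor O.monad symMonad.{u, u} where
  F := Over.forget _
  φ := O.toPolyOver.phi
  unit := O.phi_unit
  mult := O.phi_mult

/-- The terminal `R`-algebra, whose underlying object is the identity of `I`. -/
noncomputable def terminalAlgebra : O.monad.Algebra where
  A := Over.mk (𝟙 _)
  a := Over.mkIdTerminal.from _
  unit := Over.mkIdTerminal.hom_ext _ _
  assoc := Over.mkIdTerminal.hom_ext _ _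

/-- The simplicial groupoid `D_• = S F_! R^• A`, with `A` the terminal `R`-algebra. -/
noncomputable def D : SimplicialObj Grpd.{u, u} := O.opfunctor.bar O.terminalAlgebra

end Operad

end FaaDiBruno

/-! Write `top` for the natural transformation `μ^S ∘ S φ : S F_! R ⟶ S F_!`. The square formed by
`d_0` and the top faces is the naturality square of `top` at the arrow `R^n α : R^(n+1) A ⟶ R^n A`,
so strict pullbacks follow once `top` is cartesian. This has three ingredients. First, `φ` is
cartesian (`PolyOver.isStrictPullback_phi`): an object of `R X` is an object of `R Y` together with
a lift to `X` of its tuple of inputs. Second, `S` preserves strict pullbacks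
(`Sym.isStrictPullback_map`), since these are formed componentwise over a common bijection. Third,
`μ^S` is cartesian (`Sym.isStrictPullback_mult`): a tuple of tuples in `X` is a flat tuple in `X`
together with a cutting into blocks of its image in `Y`. Pasting gives
`Operad.isStrictPullback_top`.

A strict pullback of groupoids along an isofibration is a homotopy pullback
(`IsStrictPullback.isHomotopyPullback`), so it remains to see that `d_0` is an isofibration. The
action `α` lands in the discrete groupoid `I`, hence is an isofibration, and both `R` and `S`
preserve isofibrations because arrows of inputs or entries lift one at a time. -/

namespace FaaDiBruno

/-! ### Strict pullback squares of categories -/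

section StrictPullback

variable {P X Y Z : Type*} [Category* P] [Category* X] [Category* Y] [Category* Z]

/-- A strictly commutative square of functors is a strict pullback if its corner is, on objects and
on arrows, the set of compatible pairs. -/
structure IsStrictPullback (fst : P ⥤ X) (snd : P ⥤ Y) (f : X ⥤ Z) (g : Y ⥤ Z) : Prop where
  w : fst ⋙ f = snd ⋙ g
  exists_obj : ∀ x y, f.obj x = g.obj y → ∃ p, fst.obj p = x ∧ snd.obj p = y
  obj_ext : ∀ p q, fst.obj p = fst.obj q → snd.obj p = snd.obj q → p = q
  exists_hom : ∀ {p q : P} (a : fst.obj p ⟶ fst.obj q) (b : snd.obj p ⟶ snd.obj q),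
    f.map a ≍ g.map b → ∃ h : p ⟶ q, fst.map h = a ∧ snd.map h = b
  hom_ext : ∀ {p q : P} (h k : p ⟶ q), fst.map h = fst.map k → snd.map h = snd.map k → h = k

/-- A functor has the lifting property of isofibrations for all arrows out of the image of an
object. For functors of groupoids this says that it is an isofibration. -/
def IsIsofibration (F : X ⥤ Y) : Prop :=
  ∀ (x : X) {y : Y} (g : F.obj x ⟶ y), ∃ (x' : X) (h : x ⟶ x'), F.obj x' = y ∧ F.map h ≍ g

/-- In a strictly commuting square the two images of an object are equal only propositionally, so
compatibility of arrows is expressed by `≍`. This lemma gives an arrow new, equal endpoints without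
leaving its `≍`-class. -/
theorem eqToHom_comp_comp_heq {C : Type*} [Category* C] {a b c d : C} (h : a = b) (g : b ⟶ c)
    (k : c = d) : eqToHom h ≫ g ≫ eqToHom k ≍ g := by
  subst h k
  simp

theorem Functor.map_heq (F : X ⥤ Y) {a b a' b' : X} {r : a ⟶ b} {r' : a' ⟶ b'} (ha : a = a')
    (hb : b = b') (h : r ≍ r') : F.map r ≍ F.map r' := by
  subst ha hb
  rw [eq_of_heq h]

theorem Functor.map_heq_of_eq {F G : X ⥤ Y} (h : F = G) {a b : X} (r : a ⟶ b) :
    F.map r ≍ G.map r := by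
  subst h
  rfl

/-- Between objects coming from the strict corner, the square defining an arrow of the homotopy
pullback has `eqToHom` as comparison maps. It thereby becomes the compatibility required by
`IsStrictPullback.exists_hom`. -/
theorem comp_eqToHom_eq_iff_heq {C : Type*} [Category* C] {a b c d : C} (f : a ⟶ b) (g : c ⟶ d)
    (h : b = d) (k : a = c) : f ≫ eqToHom h = eqToHom k ≫ g ↔ f ≍ g := by
  subst h k
  simp

theorem IsStrictPullback.flip {fst : P ⥤ X} {snd : P ⥤ Y} {f : X ⥤ Z} {g : Y ⥤ Z}
    (H : IsStrictPullback fst snd f g) : IsStrictPullback snd fst g f where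
  w := H.w.symm
  exists_obj x y h := (H.exists_obj y x h.symm).imp fun _ => And.symm
  obj_ext p q h1 h2 := H.obj_ext p q h2 h1
  exists_hom a b h := (H.exists_hom b a h.symm).imp fun _ => And.symm
  hom_ext h k h1 h2 := H.hom_ext h k h2 h1

/-- Strict pullback squares can be pasted. -/
theorem IsStrictPullback.paste {Z' Y' : Type*} [Category* Z'] [Category* Y']
    {fst : P ⥤ X} {snd : P ⥤ Y} {f : X ⥤ Z} {g : Y ⥤ Z} (H : IsStrictPullback fst snd f g)
    {snd' : Y ⥤ Y'} {f' : Z ⥤ Z'} {g' : Y' ⥤ Z'} (H' : IsStrictPullback g snd' f' g') :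
    IsStrictPullback fst (snd ⋙ snd') (f ⋙ f') g' where
  w := by rw [← Functor.assoc, H.w, Functor.assoc, H'.w, Functor.assoc]
  exists_obj x y h := by
    obtain ⟨y', h1, rfl⟩ := H'.exists_obj (f.obj x) y h
    obtain ⟨p, rfl, rfl⟩ := H.exists_obj x y' h1.symm
    exact ⟨p, rfl, rfl⟩
  obj_ext p q h1 h2 := H.obj_ext p q h1 (H'.obj_ext _ _ (by
    have hp := Functor.congr_obj H.w p
    have hq := Functor.congr_obj H.w q
    simp only [Functor.comp_obj] at hp hq
    rw [← hp, ← hq, h1]) h2)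
  exists_hom {p q} a b h := by
    have hp : f.obj (fst.obj p) = g.obj (snd.obj p) := Functor.congr_obj H.w p
    have hq : f.obj (fst.obj q) = g.obj (snd.obj q) := Functor.congr_obj H.w q
    -- The second square lifts only arrows between objects `g.obj _`, so `f.map a` is first
    -- transported to such endpoints.
    have hc := eqToHom_comp_comp_heq hp.symm (f.map a) hq
    obtain ⟨c, h1, h2⟩ := H'.exists_hom (eqToHom hp.symm ≫ f.map a ≫ eqToHom hq) b
      ((Functor.map_heq f' hp.symm hq.symm hc).trans h)
    obtain ⟨k, h3, h4⟩ := H.exists_hom a c (hc.symm.trans (heq_of_eq h1.symm))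
    exact ⟨k, h3, by rw [Functor.comp_map, h4, h2]⟩
  hom_ext {p q} h k h1 h2 := H.hom_ext h k h1 (H'.hom_ext _ _ (eq_of_heq (by
    refine (Functor.map_heq_of_eq H.w h).symm.trans (HEq.trans ?_ (Functor.map_heq_of_eq H.w k))
    rw [Functor.comp_map, h1, Functor.comp_map])) h2)

theorem IsStrictPullback.hom_ext_heq {fst : P ⥤ X} {snd : P ⥤ Y} {f : X ⥤ Z} {g : Y ⥤ Z}
    (H : IsStrictPullback fst snd f g) {p q p' q' : P} {h : p ⟶ q} {k : p' ⟶ q'} (hp : p = p')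
    (hq : q = q') (h1 : fst.map h ≍ fst.map k) (h2 : snd.map h ≍ snd.map k) : h ≍ k := by
  subst hp hq
  exact heq_of_eq (H.hom_ext h k (eq_of_heq h1) (eq_of_heq h2))

/-- The uniqueness of functors into a strict pullback. -/
theorem IsStrictPullback.functor_ext {fst : P ⥤ X} {snd : P ⥤ Y} {f : X ⥤ Z} {g : Y ⥤ Z}
    (H : IsStrictPullback fst snd f g) {W : Type*} [Category* W] {l l' : W ⥤ P}
    (h1 : l ⋙ fst = l' ⋙ fst) (h2 : l ⋙ snd = l' ⋙ snd) : l = l' := by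
  have ho : ∀ w, l.obj w = l'.obj w := fun w =>
    H.obj_ext _ _ (Functor.congr_obj h1 w) (Functor.congr_obj h2 w)
  exact Functor.hext ho fun w w' k => H.hom_ext_heq (ho w) (ho w')
    (Functor.map_heq_of_eq h1 k) (Functor.map_heq_of_eq h2 k)

/-- The existence of functors into a strict pullback. -/
theorem IsStrictPullback.exists_lift {fst : P ⥤ X} {snd : P ⥤ Y} {f : X ⥤ Z} {g : Y ⥤ Z}
    (H : IsStrictPullback fst snd f g) {W : Type*} [Category* W] (a : W ⥤ X) (b : W ⥤ Y)
    (e : a ⋙ f = b ⋙ g) : ∃ l : W ⥤ P, l ⋙ fst = a ∧ l ⋙ snd = b := by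
  -- Objects and arrows are chosen without any coherence; functoriality of the choices is forced by
  -- `hom_ext`.
  choose o ha hb using fun w => H.exists_obj (a.obj w) (b.obj w) (Functor.congr_obj e w)
  have hm : ∀ {w w' : W} (k : w ⟶ w'), ∃ m : o w ⟶ o w',
      fst.map m = eqToHom (ha w) ≫ a.map k ≫ eqToHom (ha w').symm ∧
      snd.map m = eqToHom (hb w) ≫ b.map k ≫ eqToHom (hb w').symm := fun {w w'} k =>
    H.exists_hom _ _
      ((Functor.map_heq f (ha w) (ha w') (eqToHom_comp_comp_heq _ _ _)).trans
        ((Functor.map_heq_of_eq e k).trans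
          (Functor.map_heq g (hb w) (hb w') (eqToHom_comp_comp_heq _ _ _)).symm))
  choose m hma hmb using @hm
  refine ⟨{ obj := o, map := m, map_id := fun w => ?_, map_comp := fun k k' => ?_ }, ?_, ?_⟩
  · exact H.hom_ext _ _ (by simp [hma]) (by simp [hmb])
  · exact H.hom_ext _ _ (by simp [hma]) (by simp [hmb])
  · exact Functor.hext ha fun w w' k => (heq_of_eq (hma k)).trans (eqToHom_comp_comp_heq _ _ _)
  · exact Functor.hext hb fun w w' k => (heq_of_eq (hmb k)).trans (eqToHom_comp_comp_heq _ _ _)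

end StrictPullback

/-! ### Strict pullbacks of groupoids as homotopy pullbacks -/

section Grpd

variable {P X Y Z : Grpd.{v, u}} {fst : P ⥤ X} {snd : P ⥤ Y} {f : X ⥤ Z} {g : Y ⥤ Z}

/-- A strict pullback square of groupoids is a pullback in the category of groupoids. -/
theorem IsStrictPullback.isPullback (H : IsStrictPullback fst snd f g) :
    IsPullback (C := Grpd) (P := P) (X := X) (Y := Y) (Z := Z) fst snd f g := by
  refine ⟨⟨H.w⟩, ⟨PullbackCone.IsLimit.mk (C := Grpd) H.w
    (fun s => (H.exists_lift s.fst s.snd s.condition).choose)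
    (fun s => (H.exists_lift s.fst s.snd s.condition).choose_spec.1)
    (fun s => (H.exists_lift s.fst s.snd s.condition).choose_spec.2)
    (fun s m h1 h2 => H.functor_ext ?_ ?_)⟩⟩
  · exact h1.trans (H.exists_lift s.fst s.snd s.condition).choose_spec.1.symm
  · exact h2.trans (H.exists_lift s.fst s.snd s.condition).choose_spec.2.symm

/-- A strict pullback square of groupoids along an isofibration is a homotopy pullback. -/
theorem IsStrictPullback.isHomotopyPullback (H : IsStrictPullback fst snd f g)
    (hg : IsIsofibration g) :
    IsHomotopyPullback (P := P) (X := X) (Y := Y) (Z := Z) fst snd f g := by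
  refine ⟨H.w, ?_⟩
  have hfull : (toHomotopyPullback (P := P) (X := X) (Y := Y) (Z := Z) H.w).Full := by
    refine ⟨fun {p q} k => ?_⟩
    obtain ⟨h, h1, h2⟩ := H.exists_hom k.fst k.snd ((comp_eqToHom_eq_iff_heq _ _
      (Functor.congr_obj H.w q) (Functor.congr_obj H.w p)).1 k.w)
    exact ⟨h, CategoricalPullback.hom_ext h1 h2⟩
  have hfaith : (toHomotopyPullback (P := P) (X := X) (Y := Y) (Z := Z) H.w).Faithful :=
    ⟨fun {p q} h k e => H.hom_ext h k (congrArg (fun t => t.fst) e) (congrArg (fun t => t.snd) e)⟩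
  have hess : (toHomotopyPullback (P := P) (X := X) (Y := Y) (Z := Z) H.w).EssSurj := by
    refine ⟨fun c => ?_⟩
    -- The only use of the isofibration: moving `c.snd` along a lift of the inverse comparison makes
    -- the pair strictly compatible, and the identity of `c.fst` together with `h` is an isomorphism
    -- from `c` to the strict pair.
    obtain ⟨y, h, h1, h2⟩ := hg c.snd c.iso.inv
    obtain ⟨p, h3, h4⟩ := H.exists_obj c.fst y h1.symm
    obtain ⟨x, y₀, e⟩ := c
    subst h3 h4
    have hh : g.map h = e.inv ≫ eqToHom h1.symm :=
      eq_of_heq (h2.trans (by simp))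
    let c : CategoricalPullback f g := ⟨fst.obj p, y₀, e⟩
    let c' : CategoricalPullback f g :=
      (toHomotopyPullback (P := P) (X := X) (Y := Y) (Z := Z) H.w).obj p
    let i : c.snd ≅ c'.snd := (Groupoid.isoEquivHom _ _).symm h
    refine ⟨p, ⟨(CategoricalPullback.mkIso (x := c) (y := c') (Iso.refl (fst.obj p)) i ?_).symm⟩⟩
    change f.map (𝟙 _) ≫ eqToHom (Functor.congr_obj H.w p) = e.hom ≫ g.map h
    rw [hh, f.map_id, Category.id_comp, Iso.hom_inv_id_assoc]
  exact { }

end Grpd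

end FaaDiBruno

namespace FaaDiBruno

/-! ### Families of objects -/

section Fam

variable {X Y : Type*} [Groupoid X] [Groupoid Y] {ι κ : Type*}

/-- The action of a functor on a map of families. -/
def FamHom.map (F : X ⥤ Y) {x : ι → X} {y : κ → X} (f : FamHom x y) :
    FamHom (fun i => F.obj (x i)) (fun j => F.obj (y j)) :=
  ⟨f.perm, fun i => F.map (f.fam i)⟩

/-- Each component is lifted separately; the entry of the new family at `j` is the endpoint of the
lift at the preimage of `j`. Both `S` and the polynomial functor inherit isofibrations from this. -/
theorem FamHom.exists_lift {F : X ⥤ Y} (hF : IsIsofibration F) {x : ι → X} {y : κ → Y}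
    (r : FamHom (fun i => F.obj (x i)) y) :
    ∃ (x' : κ → X) (h : FamHom x x'), (∀ j, F.obj (x' j) = y j) ∧ FamHom.map F h ≍ r := by
  obtain ⟨π, r⟩ := r
  choose x' h h1 h2 using fun i => hF (x i) (r i)
  have hy : ∀ j, F.obj (x' (π.symm j)) = y j := fun j => by simp [h1]
  -- With `y` replaced by the image of the lifted family, the lift and `r` have the same type and
  -- `≍` reduces to `=`.
  obtain rfl : (fun j => F.obj (x' (π.symm j))) = y := funext hy
  refine ⟨_, ⟨π, fun i => h i ≫ eqToHom (by simp)⟩, hy, heq_of_eq ?_⟩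
  refine FamHom.ext_heq (fun _ => rfl) fun i => ?_
  refine HEq.trans ?_ (h2 i)
  simp only [FamHom.map, Functor.map_comp, eqToHom_map, comp_eqToHom_heq_iff]
  rfl

/-- `Sym.mult` acts on arrows by conjugating `sigmaHom` with reindexings. These are invertible, so
equations between concatenated arrows can be checked on the total families, where the blocks are
visible. -/
theorem FamHom.eq_of_comp_reindex_inv {l m : Type*} {x : ι → X} {y : κ → X}
    (e : l ≃ ι) (e' : m ≃ κ) {f g : FamHom x y}
    (h : ((FamHom.reindex x e).comp f).comp (FamHom.reindex y e').inv =
      ((FamHom.reindex x e).comp g).comp (FamHom.reindex y e').inv) : f = g := by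
  have key : ∀ k : FamHom x y, (FamHom.reindex x e).inv.comp
      ((((FamHom.reindex x e).comp k).comp (FamHom.reindex y e').inv).comp
        (FamHom.reindex y e')) = k := fun k => by
    simp only [FamHom.assoc, FamHom.inv_comp, FamHom.comp_id]
    rw [← FamHom.assoc, FamHom.inv_comp, FamHom.id_comp]
  rw [← key f, h, key]

/-- The surjectivity half of the same conjugation: an arrow between concatenations can be regarded
as an arrow of total families before it is cut into blocks. -/
theorem FamHom.exists_reindex {l m : Type*} {x : ι → X} {y : κ → X}
    (e : l ≃ ι) (e' : m ≃ κ) (b : FamHom (fun k => x (e k)) (fun k => y (e' k))) :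
    ∃ f : FamHom x y,
      ((FamHom.reindex x e).comp f).comp (FamHom.reindex y e').inv = b := by
  refine ⟨(FamHom.reindex x e).inv.comp (b.comp (FamHom.reindex y e')), ?_⟩
  rw [← FamHom.assoc, FamHom.comp_inv, FamHom.id_comp, FamHom.assoc, FamHom.comp_inv,
    FamHom.comp_id]

theorem FamHom.map_comp_reindex_inv (F : X ⥤ Y) {l m : Type*} {x : ι → X} {y : κ → X}
    (e : l ≃ ι) (e' : m ≃ κ) (f : FamHom x y) :
    FamHom.map F (((FamHom.reindex x e).comp f).comp (FamHom.reindex y e').inv) =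
      ((FamHom.reindex (fun i => F.obj (x i)) e).comp (FamHom.map F f)).comp
        (FamHom.reindex (fun j => F.obj (y j)) e').inv :=
  FamHom.ext_heq (fun _ => rfl) fun i => by
    simp [FamHom.map, FamHom.comp, FamHom.reindex, FamHom.inv, eqToHom_map]

end Fam

/-! ### Isofibrations and strict pullbacks under `S` and its multiplication -/

namespace Sym

section

variable {X : Type u} [Groupoid.{v} X] {Y : Type u} [Groupoid.{v} Y]

theorem isIsofibration_map {F : X ⥤ Y} (hF : IsIsofibration F) : IsIsofibration (map F) := by
  rintro ⟨n, x⟩ ⟨m, y⟩ r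
  obtain ⟨x', h, h1, h2⟩ := FamHom.exists_lift hF (show FamHom (fun i => F.obj (x i)) y from r)
  obtain rfl : (fun j => F.obj (x' j)) = y := funext h1
  exact ⟨⟨m, x'⟩, h, rfl, h2⟩

/-- The naturality squares of the concatenation are strict pullbacks. -/
theorem isStrictPullback_mult (F : X ⥤ Y) :
    IsStrictPullback (mult X) (map (map F)) (map F) (mult Y) where
  w := (mult_naturality X F).symm
  exists_obj := by
    rintro ⟨n, x⟩ y h
    have hn : n = ((mult Y).obj y).card := congrArg Sym.card h
    subst hn
    have hx : (fun i => F.obj (x i)) = ((mult Y).obj y).val := by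
      injection h
    -- The blocks are those of `y`, and they are filled with the entries of `x` at the corresponding
    -- positions.
    refine ⟨⟨y.card, fun i => ⟨(y.val i).card, fun j => x ((sigmaEquiv y).symm ⟨i, j⟩)⟩⟩, ?_, ?_⟩
    · refine congrArg (Sym.mk _) (funext fun k => ?_)
      exact congrArg x ((sigmaEquiv y).symm_apply_apply k)
    · refine congrArg (Sym.mk _) (funext fun i => congrArg (Sym.mk _) (funext fun j => ?_))
      exact (congrFun hx _).trans (mult_val_symm y ⟨i, j⟩)
  obj_ext := by
    rintro ⟨m, p⟩ ⟨m', q⟩ h1 h2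
    obtain rfl : m = m' := congrArg Sym.card h2
    have h3 : ∀ i, (map F).obj (p i) = (map F).obj (q i) := by
      injection h2 with _ h
      exact congrFun h
    -- The images in `Y` force equal block sizes `c`. Once `p` and `q` are both written over `c`,
    -- their concatenations use the same `sigmaEquiv` and can be compared entry by entry.
    obtain ⟨c, hc⟩ : ∃ c : Fin m → ℕ, ∀ i, (p i).card = c i := ⟨_, fun _ => rfl⟩
    obtain ⟨a, rfl⟩ : ∃ a : ∀ i, Fin (c i) → X, p = fun i => ⟨c i, a i⟩ := by
      refine ⟨fun i j => (p i).val (Fin.cast (hc i).symm j), funext fun i => obj_ext (hc i) ?_⟩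
      intro; rfl
    obtain ⟨b, rfl⟩ : ∃ b : ∀ i, Fin (c i) → X, q = fun i => ⟨c i, b i⟩ := by
      have hq : ∀ i, (q i).card = c i := fun i => (congrArg Sym.card (h3 i)).symm
      refine ⟨fun i j => (q i).val (Fin.cast (hq i).symm j), funext fun i => obj_ext (hq i) ?_⟩
      intro; rfl
    refine congrArg (Sym.mk m) (funext fun i => congrArg (Sym.mk _) (funext fun j => ?_))
    have h4 : ((mult X).obj ⟨m, fun i => ⟨c i, a i⟩⟩).val =
        ((mult X).obj ⟨m, fun i => ⟨c i, b i⟩⟩).val := by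
      injection h1
    have h5 := congrFun h4 ((sigmaEquiv ⟨m, fun i => ⟨c i, a i⟩⟩).symm ⟨i, j⟩)
    exact (mult_val_symm ⟨m, fun i => ⟨c i, a i⟩⟩ ⟨i, j⟩).symm.trans
      (h5.trans (mult_val_symm ⟨m, fun i => ⟨c i, b i⟩⟩ ⟨i, j⟩))
  exists_hom {p q} b a h := by
    obtain ⟨b', hb'⟩ := FamHom.exists_reindex
      (x := fun s : (i : Fin p.card) × Fin (p.val i).card => (p.val s.1).val s.2)
      (y := fun s : (i : Fin q.card) × Fin (q.val i).card => (q.val s.1).val s.2)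
      (sigmaEquiv p) (sigmaEquiv q) b
    have h1 : FamHom.map F b' = sigmaHom a := by
      refine FamHom.eq_of_comp_reindex_inv (sigmaEquiv p) (sigmaEquiv q) ?_
      rw [← FamHom.map_comp_reindex_inv, hb']
      exact eq_of_heq h
    obtain ⟨α, a⟩ := a
    obtain ⟨π, φ⟩ := b'
    -- The bijection of `b'` is that of `sigmaHom a`, hence carries blocks to blocks; after
    -- substitution the arrows `φ` have the right targets to be cut into blocks.
    obtain rfl : π = (sigmaHom (z := (map (map F)).obj p) (z' := (map (map F)).obj q) ⟨α, a⟩).perm := congrArg FamHom.perm h1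
    have h2 : ∀ s, F.map (φ s) = FamHom.fam (a s.1) s.2 := by
      injection h1 with _ h
      exact congrFun h
    refine ⟨⟨α, fun i => ⟨FamHom.perm (a i), fun j => φ ⟨i, j⟩⟩⟩, hb', ?_⟩
    refine congrArg (FamHom.mk α) (funext fun i =>
      congrArg (FamHom.mk (FamHom.perm (a i))) (funext fun j => ?_))
    exact h2 ⟨i, j⟩
  hom_ext {p q} h k h1 h2 := by
    -- The arrows of `X` are compared through the concatenation, whereas the bijections, between and
    -- inside blocks, are compared through the images in `Y`.
    have h3 : sigmaHom h = sigmaHom k :=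
      FamHom.eq_of_comp_reindex_inv (sigmaEquiv p) (sigmaEquiv q) h1
    obtain ⟨π, h⟩ := h
    obtain ⟨π', k⟩ := k
    obtain rfl : π = π' := congrArg FamHom.perm h2
    refine congrArg (FamHom.mk π) (funext fun i => ?_)
    have h4 : (h i).perm = (k i).perm := by
      injection h2 with _ h2
      exact congrArg (FamHom.perm (x := fun j => F.obj ((p.val i).val j))
        (y := fun j => F.obj ((q.val (π i)).val j))) (congrFun h2 i)
    refine FamHom.ext_heq (fun j => by rw [h4]) fun j => ?_
    change (sigmaHom (z := p) (z' := q) ⟨π, h⟩).fam ⟨i, j⟩ ≍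
      (sigmaHom (z := p) (z' := q) ⟨π, k⟩).fam ⟨i, j⟩
    rw [h3]

end

section

variable {P X Y Z : Type u} [Groupoid.{v} P] [Groupoid.{v} X] [Groupoid.{v} Y] [Groupoid.{v} Z]
  {fst : P ⥤ X} {snd : P ⥤ Y} {f : X ⥤ Z} {g : Y ⥤ Z}

/-- The functor `S` preserves strict pullbacks. -/
theorem isStrictPullback_map (H : IsStrictPullback fst snd f g) :
    IsStrictPullback (map fst) (map snd) (map f) (map g) where
  w := by
    change map (fst ⋙ f) = map (snd ⋙ g)
    rw [H.w]
  exists_obj := by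
    rintro ⟨n, x⟩ ⟨m, y⟩ h
    obtain rfl : n = m := congrArg Sym.card h
    have h1 : ∀ i, f.obj (x i) = g.obj (y i) := by
      injection h with _ h
      exact congrFun h
    choose p h2 h3 using fun i => H.exists_obj _ _ (h1 i)
    exact ⟨⟨n, p⟩, congrArg (Sym.mk n) (funext h2), congrArg (Sym.mk n) (funext h3)⟩
  obj_ext := by
    rintro ⟨n, p⟩ ⟨m, q⟩ h1 h2
    obtain rfl : n = m := congrArg Sym.card h1
    injection h1 with _ h1
    injection h2 with _ h2
    exact congrArg (Sym.mk n) (funext fun i =>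
      H.obj_ext _ _ (congrFun h1 i) (congrFun h2 i))
  exists_hom {p q} a b h := by
    have hw : ∀ r : P, f.obj (fst.obj r) = g.obj (snd.obj r) := Functor.congr_obj H.w
    have ho : ∀ r : Sym P, (map f).obj ((map fst).obj r) = (map g).obj ((map snd).obj r) :=
      fun r => congrArg (Sym.mk r.card) (funext fun i => hw _)
    -- The common image in `S Z` forces `a` and `b` to have the same bijection; over it the arrows
    -- are lifted componentwise.
    have h1 : FamHom.perm a = FamHom.perm b := Equiv.ext fun i =>
      eq_of_heq (perm_heq (ho p) (ho q) h (HEq.refl i))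
    have h2 : ∀ i, f.map (FamHom.fam a i) ≍ g.map (FamHom.fam b i) := fun i =>
      fam_heq (ho p) (ho q) h (HEq.refl i)
    obtain ⟨π, a⟩ := a
    obtain ⟨π', b⟩ := b
    obtain rfl : π = π' := h1
    choose k h3 h4 using fun i => H.exists_hom (a i) (b i) (h2 i)
    exact ⟨⟨π, k⟩, congrArg (FamHom.mk π) (funext h3), congrArg (FamHom.mk π) (funext h4)⟩
  hom_ext := by
    rintro p q ⟨π, h⟩ ⟨π', k⟩ h1 h2
    obtain rfl : π = π' := congrArg FamHom.perm h1
    injection h1 with _ h1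
    injection h2 with _ h2
    exact congrArg (FamHom.mk π) (funext fun i =>
      H.hom_ext _ _ (congrFun h1 i) (congrFun h2 i))

end

end Sym

/-! ### The polynomial functor of an operad -/

/-- A functor to a discrete groupoid is an isofibration. -/
theorem isIsofibration_of_discrete {X : Type*} [Category* X] {I : Type*} (F : X ⥤ Discrete I) :
    IsIsofibration F := fun x y g => by
  obtain rfl : F.obj x = y := Discrete.ext (Discrete.eq_of_hom g)
  exact ⟨x, 𝟙 x, rfl, heq_of_eq (Subsingleton.elim _ _)⟩

namespace PolyOver

variable {I : Type u} (P : PolyOver I) {X Y : Over (Grpd.of (Discrete I))} (F : X ⟶ Y)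

/-- The arrow of operations is kept and only the arrows of inputs are lifted. The lifted inputs have
the right colours because `F` lies over `I`. -/
theorem isIsofibration_mapObj
    (hF : IsIsofibration (X := X.left) (Y := Y.left) F.left) : IsIsofibration (P.mapObj F) := by
  rintro a ⟨b, y, col⟩ ⟨r, s, e⟩
  obtain ⟨x', h, h1, h2⟩ := FamHom.exists_lift (κ := Fin (P.arity.obj b).card) (y := y) hF s
  obtain rfl := funext h1
  obtain rfl := eq_of_heq h2
  exact ⟨⟨b, x', fun i => (Functor.congr_obj (Over.w F) (x' i)).symm.trans (col i)⟩, ⟨r, h, e⟩,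
    rfl, HEq.rfl⟩

/-- The naturality squares of `φ` are strict pullbacks. -/
theorem isStrictPullback_phi :
    IsStrictPullback (X := Sym X.left) (Y := P.Obj Y) (Z := Sym Y.left)
      (P.phi.app X) (P.mapObj F) (Sym.map F.left) (P.phi.app Y) where
  w := rfl
  exists_obj := by
    rintro ⟨n, x⟩ ⟨b, y, col⟩ h
    obtain rfl : n = (P.arity.obj b).card := congrArg Sym.card h
    injection h with _ h
    subst h
    -- The operation comes from `R Y` and the inputs from the tuple in `X`, whose colours are those
    -- of their images in `Y`.
    exact ⟨⟨b, x, fun i => (Functor.congr_obj (Over.w F) (x i)).symm.trans (col i)⟩, rfl, rfl⟩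
  obj_ext := by
    rintro ⟨b, x, c⟩ ⟨b', x', c'⟩ h1 h2
    obtain rfl : b = b' := congrArg Obj.oper h2
    injection h1 with _ h1
    obtain rfl : x = x' := h1
    rfl
  exists_hom := by
    rintro p q a ⟨b, s, e⟩ h
    obtain rfl := eq_of_heq h
    exact ⟨⟨b, a, e⟩, rfl, rfl⟩
  hom_ext {p q} h k h1 h2 := Hom.ext'
    (congrArg (Hom.oper (a := (P.mapObj F).obj p) (b := (P.mapObj F).obj q)) h2) h1

end PolyOver

/-! ### The Segal squares of the bar construction -/

namespace Operad

variable {I : Type u} (O : Operad I)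

/-- This face is `R^n α`. The induction starts with `α`, whose target is discrete, and each further
application of `R` preserves isofibrations. -/
theorem isIsofibration_face : ∀ n : ℕ, IsIsofibration (X := (iter O.terminalAlgebra (n + 1)).left)
    (Y := (iter O.terminalAlgebra n).left) (face O.terminalAlgebra n 0).left
  | 0 => isIsofibration_of_discrete _
  | n + 1 => by
    rw [face_of_le O.terminalAlgebra (Nat.zero_le n)]
    exact O.isIsofibration_mapObj _ (isIsofibration_face n)

/-- The naturality squares of `μ^S ∘ S φ` are strict pullbacks. -/
theorem isStrictPullback_top {X Y : Over (Grpd.of (Discrete I))} (F : X ⟶ Y) :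
    IsStrictPullback (P := Sym (O.Obj X)) (X := Sym (O.Obj Y)) (Y := Sym X.left)
      (Z := Sym Y.left) (Sym.map (O.mapObj F)) (O.opfunctor.top X) (O.opfunctor.top Y)
      (Sym.map F.left) := by
  -- `S` of the square of `φ` and the square of `μ^S` share the edge `S S F`; flipping both puts
  -- this edge in the position where they are pasted.
  have h1 := Sym.isStrictPullback_map (P := O.Obj X) (X := O.Obj Y) (Y := Sym X.left)
    (Z := Sym Y.left) (O.isStrictPullback_phi F).flip
  have h2 := (Sym.isStrictPullback_mult (X := X.left) (Y := Y.left) F.left).flip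
  exact h1.paste h2

end Operad

end FaaDiBruno

theorem mainTheorem4 {I : Type u} (R : FaaDiBruno.Operad I) :
    R.D.IsCategoryObject ∧ R.D.IsSegal := by
  -- Since `d_0` out of `D_{n+2}` is `S F_! R` of this face and `d_0` out of `D_{n+1}` is `S F_!` of
  -- it, this is the Segal square in degree `n`.
  have key (n : ℕ) := R.isStrictPullback_top (FaaDiBruno.face R.terminalAlgebra n 0)
  have hd (n : ℕ) : R.D.d n 0 = _ :=
    R.opfunctor.barFace_of_le R.terminalAlgebra (Nat.zero_le n)
  have hl (n : ℕ) : R.D.d n (Fin.last _) = _ := R.opfunctor.barFace_top R.terminalAlgebra n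
  refine ⟨fun n => ?_, fun n => ?_⟩
  · rw [hd, hd, hl, hl, FaaDiBruno.face_of_le R.terminalAlgebra (Nat.zero_le n)]
    exact (key n).isPullback
  · rw [hd, hd, hl, hl, FaaDiBruno.face_of_le R.terminalAlgebra (Nat.zero_le n)]
    exact (key n).isHomotopyPullback (FaaDiBruno.Sym.isIsofibration_map (R.isIsofibration_face n))
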